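/- Let $\mathbb T$ be the unit circle with normalized Lebesgue measure, $L^2=L^2(\mathbb T)$, $L^\infty=L^\infty(\mathbb T)$, and let $H^2\subset L^2$ be the Hardy space of those $f\in L^2$ whose Fourier coefficients of negative index all vanish. Let $P:L^2\to H^2$ be the orthogonal projection, $S:H^2\to H^2$, $Sf=zf$, the shift, and $S^*$ its adjoint. An inner function is an element of $H^\infty=L^\infty\cap H^2$ that is unimodular almost everywhere on $\mathbb T$. For an inner function $\theta$ let $K_\theta=H^2\ominus\theta H^2$, let $P_\theta:L^2\to K_\theta$ be the orthogonal projection and $S_\theta=P_\theta S|_{K_\theta}$; for an inner function $\eta$ let $\mathcal S_{(\eta)}=P_{\eta H^2}S|_{\eta H^2}$, where $P_{\eta H^2}$ is the orthogonal projection onto $\eta H^2$. Put $(\mathcal Jf)(\xi)=\bar\xi f(\bar\xi)$ and $\breve f(\xi)=f(\bar\xi)$ for $\xi\in\mathbb T$. For $\phi\in L^\infty$ the restricted Hankel operator with symbol $\phi$ is $$\mathcal H_\phi:\eta H^2\to K_\theta,\qquad \mathcal H_\phi h=P_\theta\mathcal J(\phi h).$$ Theorem. Let $\eta,\theta$ be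 inner functions and let $X:\eta H^2\to K_\theta$ be a bounded linear operator. Then $X$ is a restricted Hankel operator (that is, $X=\mathcal H_\psi$ for some $\psi\in L^\infty$) if and only if there is $\phi\in L^\infty$ with $$X\mathcal S_{(\eta)}-S_\theta^*X=S^*(\theta)\otimes P\bigl(\breve\theta\,\overline{z\eta\phi}\bigr)\quad\text{on }\eta H^2,$$ where $(u\otimes v)h=\langle h,v\rangle u$. -/

import Mathlib

open MeasureTheory AddCircle
open scoped ENNReal

noncomputable section

namespace RestrictedHankel

/-- The unit circle, parametrised by `x ↦ ξ = exp (2 π i x)`, `x ∈ ℝ / ℤ`.  Under this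
parametrisation complex conjugation `ξ ↦ ξ̄` is `x ↦ -x`. -/
abbrev Torus : Type := AddCircle (1 : ℝ)

/-- Normalised Lebesgue measure on the circle. -/
abbrev μT : Measure Torus := haarAddCircle

/-- `L²` of the circle. -/
abbrev L2 : Type := Lp ℂ 2 μT

/-- `L^∞` of the circle. -/
abbrev Linf : Type := Lp ℂ ∞ μT

/-- The inclusion `L^∞ ⊆ L²`. -/
def toL2 (φ : Linf) : L2 := ((Lp.memLp φ).mono_exponent le_top).toLp φ

/-- The coordinate function `z`, i.e. `ξ ↦ ξ`, as an element of `L^∞`. -/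
def zfun : Linf := fourierLp ∞ 1

/-- Pointwise product in `L^∞`. -/
def mulInf (φ ψ : Linf) : Linf := φ • ψ

/-- The multiplication operator `M_φ : L² → L²`, `f ↦ φ f`. -/
def mulOp (φ : Linf) : L2 →L[ℂ] L2 := (ContinuousLinearMap.mul ℂ ℂ).holderL μT ∞ 2 2 φ

/-- `x ↦ -x`, i.e. `ξ ↦ ξ̄`, preserves the measure of the circle. -/
theorem measurePreserving_neg : MeasurePreserving (fun x : Torus => -x) μT μT :=
  Measure.measurePreserving_neg μT

/-- `φ̆(ξ) = φ(ξ̄)` for `φ ∈ L^∞`. -/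
def breve (φ : Linf) : Linf :=
  Lp.compMeasurePreserving (fun x : Torus => -x) measurePreserving_neg φ

/-- `f ↦ f(ξ̄)` on `L²`. -/
def reflect : L2 →L[ℂ] L2 :=
  (Lp.compMeasurePreservingₗᵢ ℂ (fun x : Torus => -x)
    measurePreserving_neg).toContinuousLinearMap

/-- The flip operator `(J f)(ξ) = ξ̄ f(ξ̄)` on `L²`. -/
def flip : L2 →L[ℂ] L2 := mulOp (star zfun) ∘L reflect

/-- The Hardy space `H²`: the elements of `L²` whose Fourier coefficients of negative index
vanish. -/
def H2 : Submodule ℂ L2 where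
  carrier := {f | ∀ n : ℤ, n < 0 → fourierCoeff (f : Torus → ℂ) n = 0}
  zero_mem' := fun n _ => by rw [← fourierBasis_repr]; simp
  add_mem' := fun {f g} hf hg n hn => by
    have h1 := hf n hn
    have h2 := hg n hn
    rw [← fourierBasis_repr] at h1 h2 ⊢
    simp [h1, h2]
  smul_mem' := fun c f hf n hn => by
    have h1 := hf n hn
    rw [← fourierBasis_repr] at h1 ⊢
    simp [h1]

/-- An inner function: an element of `H^∞ = L^∞ ∩ H²` that is unimodular almost everywhere on
the circle. -/
structure InnerFunction where
  /-- the boundary function -/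
  fn : Linf
  mem_H2 : toL2 fn ∈ H2
  norm_eq_one : ∀ᵐ x ∂μT, ‖fn x‖ = 1

/-- The Beurling subspace `θ H²`. -/
def beurling (θ : InnerFunction) : Submodule ℂ L2 := H2.map (mulOp θ.fn : L2 →ₗ[ℂ] L2)

/-- The model space `K_θ`, the orthogonal complement of `θ H²` in `H²`. -/
def modelSpace (θ : InnerFunction) : Submodule ℂ L2 := H2 ⊓ (beurling θ)ᗮ

theorem isClosed_H2 : IsClosed (H2 : Set L2) := by
  have : (H2 : Set L2) = ⋂ (n : ℤ) (_ : n < 0), {f | inner ℂ (fourierLp 2 n : L2) f = 0} := by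
    ext f
    simp only [Set.mem_iInter, Set.mem_ofPred_eq]
    refine forall_congr' fun n => forall_congr' fun _ => ?_
    rw [← fourierBasis_repr, fourierBasis.repr_apply_apply, coe_fourierBasis]
  rw [this]
  exact isClosed_iInter fun n => isClosed_iInter fun _ =>
    isClosed_eq (by fun_prop) continuous_const

theorem norm_mulOp (θ : InnerFunction) (f : L2) : ‖mulOp θ.fn f‖ = ‖f‖ := by
  rw [Lp.norm_def, Lp.norm_def]
  congr 1
  refine eLpNorm_congr_norm_ae ?_
  have h : (mulOp θ.fn f : Torus → ℂ) =ᵐ[μT] fun x => θ.fn x * f x :=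
    ContinuousLinearMap.coeFn_holder (ContinuousLinearMap.mul ℂ ℂ) θ.fn f
  filter_upwards [h, θ.norm_eq_one] with x hx h1
  rw [hx, norm_mul, h1, one_mul]

instance : CompleteSpace H2 := isClosed_H2.completeSpace_coe

theorem isClosed_beurling (θ : InnerFunction) : IsClosed (beurling θ : Set L2) := by
  have hi : Isometry (mulOp θ.fn) :=
    AddMonoidHomClass.isometry_of_norm _ (norm_mulOp θ)
  exact hi.isClosedEmbedding.isClosedMap _ isClosed_H2

instance (θ : InnerFunction) : CompleteSpace (beurling θ) :=
  (isClosed_beurling θ).completeSpace_coe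

theorem isClosed_modelSpace (θ : InnerFunction) : IsClosed (modelSpace θ : Set L2) :=
  isClosed_H2.inter (Submodule.isClosed_orthogonal _)

instance (θ : InnerFunction) : CompleteSpace (modelSpace θ) :=
  (isClosed_modelSpace θ).completeSpace_coe

/-- The Szegő projection `P : L² → H²`. -/
def szego : L2 →L[ℂ] H2 := H2.orthogonalProjectionOnto

/-- The forward shift `S = T_z` on `H²`, `f ↦ P (z f)`. -/
def shift : H2 →L[ℂ] H2 := szego ∘L mulOp zfun ∘L H2.subtypeL

/-- The backward shift `S*` on `H²`. -/
def backwardShift : H2 →L[ℂ] H2 := ContinuousLinearMap.adjoint shift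

/-- The compression `𝒮_(η) = P_{ηH²} S |_{ηH²}` of the shift to `η H²`. -/
def beurlingShift (η : InnerFunction) : beurling η →L[ℂ] beurling η :=
  (beurling η).orthogonalProjectionOnto ∘L mulOp zfun ∘L (beurling η).subtypeL

/-- The compressed shift `S_θ = P_θ S |_{K_θ}` on the model space. -/
def compressedShift (θ : InnerFunction) : modelSpace θ →L[ℂ] modelSpace θ :=
  (modelSpace θ).orthogonalProjectionOnto ∘L mulOp zfun ∘L (modelSpace θ).subtypeL

/-- The restricted Hankel operator `ηH² → K_θ`, `h ↦ P_θ J (φ h)`. -/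
def restrictedHankel (η θ : InnerFunction) (φ : Linf) : beurling η →L[ℂ] modelSpace θ :=
  (modelSpace θ).orthogonalProjectionOnto ∘L flip ∘L mulOp φ ∘L (beurling η).subtypeL

/-- `X : ηH² → K_θ` is a restricted Hankel operator: it has a bounded symbol. -/
def IsRestrictedHankel (η θ : InnerFunction) (X : beurling η →L[ℂ] modelSpace θ) : Prop :=
  ∃ φ : Linf, X = restrictedHankel η θ φ

/-- The element `θ` of `H²`. -/
def InnerFunction.toH2 (θ : InnerFunction) : H2 := ⟨toL2 θ.fn, θ.mem_H2⟩

/-- The vector `P(θ̆ · conj (z η φ))` of `H²`. -/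
def hankelVector (η θ : InnerFunction) (φ : Linf) : H2 :=
  szego (toL2 (mulInf (breve θ.fn) (star (mulInf zfun (mulInf η.fn φ)))))

end RestrictedHankel

end

/-!
The proof compares `X` with the restricted Hankel operator whose symbol is `η φ`.

*A restricted Hankel operator satisfies the equation.*  Write `M_f` for multiplication by `f` and
let `g = 𝒥(η φ h)`.  Since `𝒥 M_z = M_{z̄} 𝒥`, the left-hand side applied to `h` is
`P_θ (z̄ (g - P_θ g))`.  For `k ∈ K_θ` one has `z k ∈ K_θ ⊕ ℂ θ`, so for `r ⊥ K_θ` the vector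
`P_θ (z̄ r)` is `⟨r, θ⟩ P_θ (z̄ θ) = ⟨r, θ⟩ S* θ`.  Moving `𝒥` and the multipliers to the other side
turns `⟨g, θ⟩` into the pairing of `h` with the vector of the rank-one operator.  This is
`restrictedHankel_intertwining`; as `η` is unimodular, every symbol is of the form `η φ`.

*Conversely*, if `X` satisfies the equation for `φ`, the difference `D` of `X` and the restricted
Hankel operator with symbol `η φ` satisfies `D 𝒮_(η) = S_θ* D`.  Then `Γ = D M_η`, regarded as an
operator on `H²`, satisfies `Γ S = S* Γ`, that is, it is a Hankel operator, and Nehari's theorem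
(`exists_symbol`) gives a bounded symbol `ψ` of `Γ`; hence `D` has the symbol `η̄ ψ`.

Nehari's theorem is proved by dilation.  For a contraction `Γ`, two isometric copies `A`, `B` of
`H²` are placed in one Hilbert space so that `⟨A f, B g⟩ = ⟨f, Γ g⟩`.  The Hankel relation says
exactly that `A f + B (S g) ↦ A (S f) + B g` is isometric, so it is induced by a contraction `T`
(`exists_coupling`).  The family `T(n)`, equal to `T ^ n` for `n ≥ 0` and to `T* ^ (-n)` for
`n < 0`, is positive definite (`twoSidedPow.norm_sq_le_re_sum`).  Testing positivity on combinations
of `A 1` and `B 1` shows that the sequence of the numbers `⟨T(n) A 1, B 1⟩`, which extends the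
conjugate of the Hankel sequence of `Γ` to negative indices, has a contractive Toeplitz form
(`exists_contractive_toeplitz`).  Such a sequence consists of the Fourier coefficients of a function
bounded by one (`exists_Linf_of_contractive_toeplitz`).
-/

/-! ### Positive definiteness of the powers of a contraction -/

open ContinuousLinearMap in
/-- The two-sided power family of an operator: `T ^ n` for `n ≥ 0` and `(T†) ^ (-n)` for `n < 0`. -/
noncomputable def twoSidedPow {H : Type*} [NormedAddCommGroup H] [InnerProductSpace ℂ H]
    [CompleteSpace H] (T : H →L[ℂ] H) : ℤ → H →L[ℂ] H
  | Int.ofNat n => T ^ n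
  | Int.negSucc n => adjoint T ^ (n + 1)

namespace twoSidedPow

open ContinuousLinearMap

variable {H : Type*} [NormedAddCommGroup H] [InnerProductSpace ℂ H] [CompleteSpace H]
  (T : H →L[ℂ] H)

theorem natCast (n : ℕ) : twoSidedPow T n = T ^ n := rfl

theorem neg_natCast (n : ℕ) : twoSidedPow T (-(n : ℤ)) = adjoint T ^ n := by
  cases n with
  | zero => rfl
  | succ n => rfl

theorem adjoint_eq (n : ℤ) : adjoint (twoSidedPow T n) = twoSidedPow T (-n) := by
  obtain ⟨m, rfl | rfl⟩ := n.eq_nat_or_neg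
  · rw [neg_natCast, natCast, ← star_eq_adjoint, ← star_eq_adjoint, star_pow]
  · rw [neg_neg, neg_natCast, natCast, ← star_eq_adjoint, ← star_eq_adjoint, star_pow, star_star]

theorem inner_neg (n : ℤ) (x y : H) :
    inner ℂ x (twoSidedPow T (-n) y) = inner ℂ (twoSidedPow T n x) y := by
  rw [← adjoint_eq, adjoint_inner_right]

/-- The family `n ↦ T(n)` of a contraction is positive definite, in the quantitative form that
allows an induction adding a new smallest index: with `k = ∑ T(i - a) h i`, adjoining `h a` to the
sum contributes `‖h a‖² + 2 Re ⟪h a, k⟫`, and `‖k‖² + ‖h a‖² + 2 Re ⟪h a, k⟫ = ‖h a + k‖²`. -/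
theorem norm_sq_le_re_sum (hT : ‖T‖ ≤ 1) (h : ℤ → H) (s : Finset ℤ) :
    ∀ m, (∀ i ∈ s, m ≤ i) → ‖∑ i ∈ s, twoSidedPow T (i - m) (h i)‖ ^ 2 ≤
      (∑ i ∈ s, ∑ j ∈ s, inner ℂ (h j) (twoSidedPow T (i - j) (h i))).re := by
  have hpow : ∀ (n : ℕ) (x : H), ‖(T ^ n) x‖ ≤ ‖x‖ := by
    intro n x
    induction n with
    | zero => simp
    | succ n ih =>
      rw [pow_succ']
      exact ((T.le_of_opNorm_le hT _).trans (one_mul _).le).trans ih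
  induction s using Finset.induction_on_min with
  | empty => simp
  | insert a s ha ih =>
    intro m hm
    have hna : a ∉ s := fun h' => lt_irrefl _ (ha a h')
    obtain ⟨n, hn⟩ := Int.eq_ofNat_of_zero_le (sub_nonneg.2 (hm a (Finset.mem_insert_self _ _)))
    set k := ∑ i ∈ s, twoSidedPow T (i - a) (h i) with hk
    have hsum : ∑ i ∈ insert a s, twoSidedPow T (i - m) (h i) = (T ^ n) (h a + k) := by
      rw [Finset.sum_insert hna, hn, natCast, map_add, hk, map_sum]
      congr 1
      refine Finset.sum_congr rfl fun i hi => ?_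
      obtain ⟨l, hl⟩ := Int.eq_ofNat_of_zero_le (sub_nonneg.2 (ha i hi).le)
      have : i - m = ((n + l : ℕ) : ℤ) := by push_cast; omega
      rw [this, hl, natCast, natCast, pow_add]
      rfl
    have ih' := ih a fun i hi => (ha i hi).le
    have h1 : ∑ i ∈ s, inner ℂ (h a) (twoSidedPow T (i - a) (h i)) = inner ℂ (h a) k := by
      rw [hk, inner_sum]
    have h2 : ∑ j ∈ s, inner ℂ (h j) (twoSidedPow T (a - j) (h a)) = inner ℂ k (h a) := by
      rw [hk, sum_inner]
      refine Finset.sum_congr rfl fun i _ => ?_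
      rw [← inner_neg, neg_sub]
    have h3 : twoSidedPow T (a - a) (h a) = h a := by
      rw [sub_self, ← Nat.cast_zero, natCast, pow_zero]; rfl
    rw [hsum]
    calc ‖(T ^ n) (h a + k)‖ ^ 2 ≤ ‖h a + k‖ ^ 2 := by gcongr; exact hpow _ _
      _ = ‖h a‖ ^ 2 + 2 * (inner ℂ (h a) k).re + ‖k‖ ^ 2 :=
        norm_add_sq (𝕜 := ℂ) _ _
      _ ≤ _ := by
        rw [Finset.sum_insert hna]
        simp_rw [Finset.sum_insert hna]
        rw [Finset.sum_add_distrib, h1, h2, h3]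
        have h4 : (inner ℂ k (h a)).re = (inner ℂ (h a) k).re := inner_re_symm (𝕜 := ℂ) _ _
        have h5 : (inner ℂ (h a) (h a)).re = ‖h a‖ ^ 2 := by
          simpa using (norm_sq_eq_re_inner (𝕜 := ℂ) (h a)).symm
        simp only [Complex.add_re, h4, h5]
        linarith

end twoSidedPow

/-! ### Hankel operators over an isometry -/

section Hankel

open ContinuousLinearMap

variable {E : Type*} [NormedAddCommGroup E] [InnerProductSpace ℂ E]

/-- A map that is norm-decreasing on the range of another one is induced by a contraction. -/
theorem exists_contraction_comp_eq {M H : Type*} [AddCommGroup M] [Module ℂ M]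
    [NormedAddCommGroup H] [InnerProductSpace ℂ H] [CompleteSpace H] (a b : M →ₗ[ℂ] H)
    (hab : ∀ x, ‖b x‖ ≤ ‖a x‖) : ∃ T : H →L[ℂ] H, ‖T‖ ≤ 1 ∧ ∀ x, T (a x) = b x := by
  let K := a.range.topologicalClosure
  have hK : CompleteSpace K := (a.range.isClosed_topologicalClosure).completeSpace_coe
  let a' : M →ₗ[ℂ] K := a.codRestrict K fun x => subset_closure ⟨x, rfl⟩
  have hd : DenseRange a' := by
    intro x
    rw [closure_subtype, ← Set.range_comp]
    exact x.2
  have hn : ∀ x, ‖b x‖ ≤ 1 * ‖a' x‖ := fun x => (hab x).trans (one_mul ‖a x‖).ge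
  refine ⟨b.extendOfNorm a' ∘L K.orthogonalProjectionOnto, ?_, fun x => ?_⟩
  · refine (opNorm_comp_le _ _).trans (mul_le_one₀ ?_ (norm_nonneg _) ?_)
    · exact LinearMap.opNorm_extendOfNorm_le hd zero_le_one hn
    · exact K.orthogonalProjectionOnto_norm_le
  · have : K.orthogonalProjectionOnto (a x) = a' x :=
      K.orthogonalProjectionOnto_mem_subspace_eq_self (a' x)
    rw [comp_apply, this, LinearMap.extendOfNorm_eq hd ⟨1, hn⟩]

variable [CompleteSpace E]

/-- Two isometric copies of `E` in a common Hilbert space, placed so that the inner product between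
them is given by the contraction `Γ`. If `Γ` is a Hankel operator for the isometry `S`, then `S`
on the first copy and the backward direction of `S` on the second copy fit together to an isometry
between subspaces, hence are both restrictions of one contraction `T`. -/
theorem exists_coupling (S Γ : E →L[ℂ] E) (hS : ∀ x, ‖S x‖ = ‖x‖) (hΓ : ‖Γ‖ ≤ 1)
    (hc : ∀ x y, inner ℂ (S x) (Γ y) = inner ℂ x (Γ (S y))) :
    ∃ (T : WithLp 2 (E × E) →L[ℂ] WithLp 2 (E × E)) (A B : E →ₗ[ℂ] WithLp 2 (E × E)),
      ‖T‖ ≤ 1 ∧ (∀ x y, inner ℂ (A x) (A y) = inner ℂ x y) ∧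
      (∀ x y, inner ℂ (B x) (B y) = inner ℂ x y) ∧
      (∀ x y, inner ℂ (A x) (B y) = inner ℂ x (Γ y)) ∧
      (∀ x, T (A x) = A (S x)) ∧ ∀ x, T (B (S x)) = B x := by
  have hpos : (0 : E →L[ℂ] E) ≤ 1 - star Γ * Γ := by
    rw [sub_nonneg]
    refine (CStarAlgebra.norm_le_one_iff_of_nonneg _ (star_mul_self_nonneg Γ)).1 ?_
    rw [CStarRing.norm_star_mul_self]
    exact mul_le_one₀ hΓ (norm_nonneg _) hΓ
  obtain ⟨D, hD⟩ := CStarAlgebra.nonneg_iff_eq_star_mul_self.1 hpos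
  have hD' : ∀ x y, inner ℂ (Γ x) (Γ y) + inner ℂ (D x) (D y) = inner ℂ x y := by
    intro x y
    rw [← adjoint_inner_right Γ, ← adjoint_inner_right D, ← inner_add_right]
    have : (adjoint D) (D y) = y - (adjoint Γ) (Γ y) := by
      have := congrArg (fun F : E →L[ℂ] E => F y) hD
      simpa [star_eq_adjoint] using this.symm
    rw [this, add_sub_cancel]
  let A : E →ₗ[ℂ] WithLp 2 (E × E) :=
    (WithLp.linearEquiv 2 ℂ (E × E)).symm.toLinearMap ∘ₗ LinearMap.inl ℂ E E
  let B : E →ₗ[ℂ] WithLp 2 (E × E) :=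
    (WithLp.linearEquiv 2 ℂ (E × E)).symm.toLinearMap ∘ₗ (Γ : E →ₗ[ℂ] E).prod (D : E →ₗ[ℂ] E)
  have hAA : ∀ x y, inner ℂ (A x) (A y) = inner ℂ x y := by
    intro x y; simp [A, WithLp.prod_inner_apply]
  have hBB : ∀ x y, inner ℂ (B x) (B y) = inner ℂ x y := by
    intro x y; simp [B, WithLp.prod_inner_apply, hD']
  have hAB : ∀ x y, inner ℂ (A x) (B y) = inner ℂ x (Γ y) := by
    intro x y; simp [A, B, WithLp.prod_inner_apply]
  have hnorm : ∀ x y, ‖A x + B y‖ ^ 2 = ‖x‖ ^ 2 + 2 * (inner ℂ x (Γ y)).re + ‖y‖ ^ 2 := by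
    intro x y
    have h1 : ‖A x‖ ^ 2 = ‖x‖ ^ 2 := by
      rw [norm_sq_eq_re_inner (𝕜 := ℂ), hAA, ← norm_sq_eq_re_inner]
    have h2 : ‖B y‖ ^ 2 = ‖y‖ ^ 2 := by
      rw [norm_sq_eq_re_inner (𝕜 := ℂ), hBB, ← norm_sq_eq_re_inner]
    rw [norm_add_sq (𝕜 := ℂ), h1, h2, hAB]
    rfl
  obtain ⟨T, hT, hT'⟩ := exists_contraction_comp_eq
    (A.coprod (B ∘ₗ (S : E →ₗ[ℂ] E))) ((A ∘ₗ (S : E →ₗ[ℂ] E)).coprod B) (by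
      rintro ⟨x, y⟩
      have h : ‖A (S x) + B y‖ ^ 2 ≤ ‖A x + B (S y)‖ ^ 2 := by
        rw [hnorm, hnorm, hS, hS, hc]
      exact (sq_le_sq₀ (norm_nonneg _) (norm_nonneg _)).1 h)
  refine ⟨T, A, B, hT, hAA, hBB, hAB, fun x => ?_, fun x => ?_⟩
  · simpa using hT' (x, 0)
  · simpa using hT' (0, x)

/-- Abstract form of Nehari's theorem: the sequence of a contractive Hankel operator on `ℕ`
extends to a sequence on `ℤ` whose Toeplitz form is contractive. -/
theorem exists_contractive_toeplitz (S Γ : E →L[ℂ] E) (hS : ∀ x, ‖S x‖ = ‖x‖) (hΓ : ‖Γ‖ ≤ 1)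
    (hc : ∀ x y, inner ℂ (S x) (Γ y) = inner ℂ x (Γ (S y))) (e : E)
    (he : ∀ n : ℕ, inner ℂ ((S ^ n) e) e = if n = 0 then (1 : ℂ) else 0) :
    ∃ c : ℤ → ℂ, (∀ n : ℕ, c n = inner ℂ (Γ e) ((S ^ n) e)) ∧
      ∀ (s : Finset ℤ) (p q : ℤ → ℂ),
        ‖∑ i ∈ s, ∑ j ∈ s, p i * star (q j) * c (i - j)‖ ^ 2 ≤
          (∑ i ∈ s, ‖p i‖ ^ 2) * ∑ j ∈ s, ‖q j‖ ^ 2 := by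
  obtain ⟨T, A, B, hT, hAA, hBB, hAB, hTA, hTB⟩ := exists_coupling S Γ hS hΓ hc
  have hTpA : ∀ n : ℕ, (T ^ n) (A e) = A ((S ^ n) e) := by
    intro n
    induction n with
    | zero => simp
    | succ n ih =>
      rw [pow_succ', pow_succ']
      change T ((T ^ n) (A e)) = A (S ((S ^ n) e))
      rw [ih, hTA]
  -- a contraction that preserves the norm of a vector is undone on it by its adjoint
  have hTadj : ∀ x, adjoint T (B x) = B (S x) := by
    intro x
    have hn : ‖B x‖ = ‖B (S x)‖ := by
      have hB : ∀ y, ‖B y‖ = ‖y‖ := fun y => by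
        rw [norm_eq_sqrt_re_inner (𝕜 := ℂ), hBB, ← norm_eq_sqrt_re_inner]
      rw [hB, hB, hS]
    have h1 : ‖adjoint T (B x)‖ ≤ ‖B x‖ := by
      refine ((adjoint T).le_of_opNorm_le (c := 1) ?_ _).trans (by simp)
      rwa [LinearIsometryEquiv.norm_map]
    rw [← sub_eq_zero, ← norm_eq_zero, ← sq_eq_zero_iff]
    have h2 := norm_sub_sq (𝕜 := ℂ) (adjoint T (B x)) (B (S x))
    rw [adjoint_inner_left, hTB, ← norm_sq_eq_re_inner] at h2
    nlinarith [norm_nonneg (adjoint T (B x)), sq_nonneg ‖adjoint T (B x) - B (S x)‖]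
  have hTpB : ∀ n : ℕ, (adjoint T ^ n) (B e) = B ((S ^ n) e) := by
    intro n
    induction n with
    | zero => simp
    | succ n ih =>
      rw [pow_succ', pow_succ']
      change adjoint T ((adjoint T ^ n) (B e)) = B (S ((S ^ n) e))
      rw [ih, hTadj]
  have he' : ∀ n : ℕ, inner ℂ e ((S ^ n) e) = if n = 0 then (1 : ℂ) else 0 := by
    intro n
    rw [← inner_conj_symm, he]
    split_ifs <;> simp
  have haa : ∀ n : ℤ, inner ℂ (A e) (twoSidedPow T n (A e)) = if n = 0 then (1 : ℂ) else 0 := by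
    intro n
    obtain ⟨m, rfl | rfl⟩ := n.eq_nat_or_neg
    · rw [twoSidedPow.natCast, hTpA, hAA, he']; simp
    · rw [twoSidedPow.inner_neg, twoSidedPow.natCast, hTpA, hAA, he]; simp
  have hbb : ∀ n : ℤ, inner ℂ (B e) (twoSidedPow T n (B e)) = if n = 0 then (1 : ℂ) else 0 := by
    intro n
    obtain ⟨m, rfl | rfl⟩ := n.eq_nat_or_neg
    · rw [← neg_neg (m : ℤ), twoSidedPow.inner_neg, twoSidedPow.neg_natCast, hTpB, hBB, he]; simp
    · rw [twoSidedPow.neg_natCast, hTpB, hBB, he']; simp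
  let c : ℤ → ℂ := fun n => inner ℂ (B e) (twoSidedPow T n (A e))
  have hba : ∀ n, inner ℂ (A e) (twoSidedPow T n (B e)) = star (c (-n)) := by
    intro n
    rw [← neg_neg n, twoSidedPow.inner_neg, ← inner_conj_symm, neg_neg]
    rfl
  refine ⟨c, fun n => ?_, fun s p q => ?_⟩
  · rw [← inner_conj_symm (Γ e), ← hAB, inner_conj_symm, ← hTpA]
    rfl
  set W := ∑ i ∈ s, ∑ j ∈ s, p i * star (q j) * c (i - j) with hW
  set P := ∑ i ∈ s, ‖p i‖ ^ 2 with hP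
  set Q := ∑ j ∈ s, ‖q j‖ ^ 2 with hQ
  have key : ∀ t : ℂ, 0 ≤ ‖t‖ ^ 2 * P + 2 * (t * W).re + Q := by
    intro t
    by_cases hs : s.Nonempty
    swap
    · rw [Finset.not_nonempty_iff_eq_empty] at hs
      simp [hW, hP, hQ, hs]
    have h1 := (sq_nonneg _).trans (twoSidedPow.norm_sq_le_re_sum T hT
      (fun i => (t * p i) • A e + q i • B e) s (s.min' hs) fun i hi => s.min'_le i hi)
    have h2 : ∀ i j, inner ℂ ((t * p j) • A e + q j • B e)
        (twoSidedPow T (i - j) ((t * p i) • A e + q i • B e)) =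
        star (t * p j) * (t * p i) * (if i = j then 1 else 0) +
        star (q j) * q i * (if i = j then 1 else 0) +
        (t * (p i * star (q j) * c (i - j)) + star (t * (p j * star (q i) * c (j - i)))) := by
      intro i j
      simp only [map_add, map_smul, inner_add_left, inner_add_right, inner_smul_left,
        inner_smul_right, haa, hbb, hba, sub_eq_zero, neg_sub, star_mul', star_star]
      simp only [c, starRingEnd_apply, star_mul']
      ring
    simp only [h2, Finset.sum_add_distrib] at h1
    have h3 : ∑ i ∈ s, ∑ j ∈ s, t * (p i * star (q j) * c (i - j)) = t * W := by
      simp only [hW, Finset.mul_sum]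
    have h4 : ∑ i ∈ s, ∑ j ∈ s, star (t * (p j * star (q i) * c (j - i))) = star (t * W) := by
      rw [← h3, Finset.sum_comm, star_sum]
      simp only [star_sum]
    have h5 : ∑ i ∈ s, ∑ j ∈ s, star (t * p j) * (t * p i) * (if i = j then 1 else 0) =
        ((‖t‖ ^ 2 * P : ℝ) : ℂ) := by
      rw [hP]; push_cast
      rw [Finset.mul_sum]
      refine Finset.sum_congr rfl fun i hi => ?_
      simp [hi]
      rw [← Complex.conj_mul', ← Complex.conj_mul']
      ring
    have h6 : ∑ i ∈ s, ∑ j ∈ s, star (q j) * q i * (if i = j then 1 else 0) = ((Q : ℝ) : ℂ) := by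
      rw [hQ]; push_cast
      refine Finset.sum_congr rfl fun i hi => ?_
      simp [hi]
      rw [← Complex.conj_mul']
    rw [h3, h4, h5, h6] at h1
    simp only [Complex.add_re, Complex.ofReal_re, Complex.star_def, Complex.conj_re] at h1
    linarith
  -- the choice `t = -x W̄`, `x` real, turns positivity into a quadratic inequality in `x`
  have key2 : ∀ x : ℝ, 0 ≤ (‖W‖ ^ 2 * P) * (x * x) + (-2 * ‖W‖ ^ 2) * x + Q := by
    intro x
    have h := key (-(x : ℂ) * star W)
    have h1 : (-(x : ℂ) * star W * W) = ((-(x * ‖W‖ ^ 2) : ℝ) : ℂ) := by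
      push_cast
      rw [← Complex.conj_mul']
      simp; ring
    rw [h1, Complex.ofReal_re, norm_mul, norm_neg, norm_star, Complex.norm_real, mul_pow,
      Real.norm_eq_abs, sq_abs] at h
    linarith
  have h := discrim_le_zero key2
  rw [discrim] at h
  by_cases hW0 : ‖W‖ = 0
  · rw [hW0]
    simpa using mul_nonneg (Finset.sum_nonneg fun i _ => sq_nonneg ‖p i‖)
      (Finset.sum_nonneg fun j _ => sq_nonneg ‖q j‖)
  have : 0 < ‖W‖ ^ 2 := by positivity
  have h' : ‖W‖ ^ 2 * (‖W‖ ^ 2 - P * Q) ≤ 0 := by linarith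
  nlinarith

/-- The matrix of a bounded Hankel operator is a positive multiple of a sequence on `ℤ` whose
Toeplitz form is contractive. -/
theorem exists_toeplitz_of_hankel (S Γ : E →L[ℂ] E) (hS : ∀ x, ‖S x‖ = ‖x‖)
    (hc : ∀ x y, inner ℂ (S x) (Γ y) = inner ℂ x (Γ (S y))) (e : E)
    (he : ∀ n : ℕ, inner ℂ ((S ^ n) e) e = if n = 0 then (1 : ℂ) else 0) :
    ∃ (r : ℝ) (c : ℤ → ℂ),
      (∀ k m : ℕ, inner ℂ ((S ^ k) e) (Γ ((S ^ m) e)) = r * star (c (k + m : ℕ))) ∧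
      ∀ (s : Finset ℤ) (p q : ℤ → ℂ),
        ‖∑ i ∈ s, ∑ j ∈ s, p i * star (q j) * c (i - j)‖ ^ 2 ≤
          (∑ i ∈ s, ‖p i‖ ^ 2) * ∑ j ∈ s, ‖q j‖ ^ 2 := by
  let r : ℝ := ‖Γ‖ + 1
  have hr : 0 < r := by positivity
  have hr' : (r : ℂ) ≠ 0 := by exact_mod_cast hr.ne'
  have hΓn : ‖(r⁻¹ : ℂ) • Γ‖ ≤ 1 := by
    rw [norm_smul, norm_inv, Complex.norm_real, Real.norm_of_nonneg hr.le, inv_mul_le_one₀ hr]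
    exact (lt_add_one _).le
  obtain ⟨c, hc', hb⟩ := exists_contractive_toeplitz S ((r⁻¹ : ℂ) • Γ) hS hΓn
    (fun x y => by simp [hc]) e he
  refine ⟨r, c, fun k m => ?_, hb⟩
  have hpow : ∀ (n : ℕ) (x y : E), inner ℂ ((S ^ n) x) (Γ y) = inner ℂ x (Γ ((S ^ n) y)) := by
    intro n
    induction n with
    | zero => simp
    | succ n ih =>
      intro x y
      conv_lhs => rw [pow_succ']
      rw [pow_succ]
      change inner ℂ (S ((S ^ n) x)) (Γ y) = inner ℂ x (Γ ((S ^ n) (S y)))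
      rw [hc, ih]
  have h1 : (S ^ m) ((S ^ k) e) = (S ^ (k + m)) e := by
    rw [add_comm, pow_add]; rfl
  rw [← hpow, h1, hc', Complex.star_def, inner_conj_symm]
  simp [inner_smul_right, hr']

end Hankel

noncomputable section

namespace RestrictedHankel

/-! ### Multiplication operators on the circle -/

/-- The monomial `zⁿ`, as an element of `L²`. -/
abbrev zpowL2 (n : ℤ) : L2 := fourierLp 2 n

theorem coeFn_mulOp (φ : Linf) (f : L2) : (mulOp φ f : Torus → ℂ) =ᵐ[μT] fun x => φ x * f x :=
  ContinuousLinearMap.coeFn_holder (ContinuousLinearMap.mul ℂ ℂ) φ f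

theorem coeFn_mulInf (φ ψ : Linf) : (mulInf φ ψ : Torus → ℂ) =ᵐ[μT] fun x => φ x * ψ x :=
  Lp.coeFn_lpSMul φ ψ

theorem coeFn_toL2 (φ : Linf) : (toL2 φ : Torus → ℂ) =ᵐ[μT] φ :=
  MemLp.coeFn_toLp _

theorem coeFn_star_Linf (φ : Linf) : (star φ : Linf) =ᵐ[μT] fun x => star (φ x) :=
  Lp.coeFn_star φ

theorem coeFn_zfun : zfun =ᵐ[μT] fun x => fourier 1 x :=
  coeFn_fourierLp _ _

theorem coeFn_flip (f : L2) :
    (flip f : Torus → ℂ) =ᵐ[μT] fun x => star (fourier 1 x : ℂ) * f (-x) := by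
  have h : (reflect f : Torus → ℂ) =ᵐ[μT] fun x => f (-x) :=
    Lp.coeFn_compMeasurePreserving f measurePreserving_neg
  filter_upwards [coeFn_mulOp (star zfun) (reflect f), h, coeFn_star_Linf zfun, coeFn_zfun]
    with x h1 h2 h3 h4
  rw [flip, ContinuousLinearMap.comp_apply, h1, h2, h3, h4]

theorem coeFn_breve (φ : Linf) : (breve φ : Torus → ℂ) =ᵐ[μT] fun x => φ (-x) :=
  Lp.coeFn_compMeasurePreserving φ measurePreserving_neg

theorem ae_neg {p : Torus → Prop} (h : ∀ᵐ x ∂μT, p x) : ∀ᵐ x ∂μT, p (-x) :=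
  measurePreserving_neg.quasiMeasurePreserving.ae h

theorem mulOp_mulInf (φ ψ : Linf) (f : L2) : mulOp (mulInf φ ψ) f = mulOp φ (mulOp ψ f) := by
  apply Lp.ext
  filter_upwards [coeFn_mulOp (mulInf φ ψ) f, coeFn_mulOp φ (mulOp ψ f), coeFn_mulOp ψ f,
    coeFn_mulInf φ ψ] with x h1 h2 h3 h4
  rw [h1, h2, h3, h4, mul_assoc]

theorem mulOp_comm (φ ψ : Linf) (f : L2) : mulOp φ (mulOp ψ f) = mulOp ψ (mulOp φ f) := by
  apply Lp.ext
  filter_upwards [coeFn_mulOp ψ (mulOp φ f), coeFn_mulOp φ (mulOp ψ f), coeFn_mulOp ψ f,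
    coeFn_mulOp φ f] with x h1 h2 h3 h4
  rw [h1, h2, h3, h4]; ring

theorem mulOp_star_mulOp {φ : Linf} (hφ : ∀ᵐ x ∂μT, ‖φ x‖ = 1) (f : L2) :
    mulOp (star φ) (mulOp φ f) = f := by
  apply Lp.ext
  filter_upwards [coeFn_mulOp (star φ) (mulOp φ f), coeFn_mulOp φ f, coeFn_star_Linf φ, hφ]
    with x h1 h2 h3 h4
  rw [h1, h2, h3, ← mul_assoc, Complex.star_def, Complex.conj_mul', h4]; simp

theorem norm_fourierLp (n : ℤ) : ∀ᵐ x ∂μT, ‖(fourierLp ∞ n : Linf) x‖ = 1 := by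
  filter_upwards [coeFn_fourierLp ∞ n] with x hx
  rw [hx, fourier_apply]
  exact Circle.norm_coe _

theorem norm_zfun : ∀ᵐ x ∂μT, ‖zfun x‖ = 1 := norm_fourierLp 1

theorem inner_mulOp_left (φ : Linf) (f g : L2) :
    inner ℂ (mulOp φ f) g = inner ℂ f (mulOp (star φ) g) := by
  rw [L2.inner_def, L2.inner_def]
  refine integral_congr_ae ?_
  filter_upwards [coeFn_mulOp φ f, coeFn_mulOp (star φ) g, coeFn_star_Linf φ] with x h1 h2 h3
  rw [h1, h2, h3]
  simp only [RCLike.inner_apply, map_mul, Complex.star_def]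
  ring

theorem inner_mulOp_right (φ : Linf) (f g : L2) :
    inner ℂ f (mulOp φ g) = inner ℂ (mulOp (star φ) f) g := by
  rw [inner_mulOp_left, star_star]

theorem inner_mulOp_mulOp {φ : Linf} (hφ : ∀ᵐ x ∂μT, ‖φ x‖ = 1) (f g : L2) :
    inner ℂ (mulOp φ f) (mulOp φ g) = inner ℂ f g := by
  rw [inner_mulOp_left, mulOp_star_mulOp hφ]

theorem mulOp_toL2 (φ ψ : Linf) : mulOp φ (toL2 ψ) = toL2 (mulInf φ ψ) := by
  apply Lp.ext
  filter_upwards [coeFn_mulOp φ (toL2 ψ), coeFn_toL2 ψ, coeFn_toL2 (mulInf φ ψ),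
    coeFn_mulInf φ ψ] with x h1 h2 h3 h4
  rw [h1, h2, h3, h4]

theorem star_mulInf (φ ψ : Linf) : star (mulInf φ ψ) = mulInf (star φ) (star ψ) := by
  apply Lp.ext
  filter_upwards [coeFn_star_Linf (mulInf φ ψ), coeFn_mulInf φ ψ, coeFn_mulInf (star φ) (star ψ),
    coeFn_star_Linf φ, coeFn_star_Linf ψ] with x h1 h2 h3 h4 h5
  rw [h1, h2, h3, h4, h5, star_mul']

theorem mulInf_star_mulInf {φ : Linf} (hφ : ∀ᵐ x ∂μT, ‖φ x‖ = 1) (ψ : Linf) :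
    mulInf φ (mulInf (star φ) ψ) = ψ := by
  apply Lp.ext
  filter_upwards [coeFn_mulInf φ (mulInf (star φ) ψ), coeFn_mulInf (star φ) ψ,
    coeFn_star_Linf φ, hφ] with x h1 h2 h3 h4
  rw [h1, h2, h3, ← mul_assoc, Complex.star_def, Complex.mul_conj', h4]
  simp

theorem toL2_eq_mulOp (φ : Linf) : toL2 φ = mulOp φ (zpowL2 0) := by
  apply Lp.ext
  filter_upwards [coeFn_toL2 φ, coeFn_mulOp φ (zpowL2 0), coeFn_fourierLp 2 (0 : ℤ)]
    with x h1 h2 h3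
  rw [h1, h2, h3]
  simp

theorem toL2_fourierLp (n : ℤ) : toL2 (fourierLp ∞ n) = zpowL2 n := by
  apply Lp.ext
  filter_upwards [coeFn_toL2 (fourierLp ∞ n), coeFn_fourierLp ∞ n, coeFn_fourierLp 2 n]
    with x h1 h2 h3
  rw [h1, h2, h3]

theorem mulOp_fourierLp (m n : ℤ) : mulOp (fourierLp ∞ m) (zpowL2 n) = zpowL2 (m + n) := by
  apply Lp.ext
  filter_upwards [coeFn_mulOp (fourierLp ∞ m) (zpowL2 n), coeFn_fourierLp ∞ m, coeFn_fourierLp 2 n,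
    coeFn_fourierLp 2 (m + n)] with x h1 h2 h3 h4
  rw [h1, h2, h3, h4, fourier_add]

theorem star_fourierLp (n : ℤ) : star (fourierLp ∞ n : Linf) = fourierLp ∞ (-n) := by
  apply Lp.ext
  filter_upwards [coeFn_star_Linf (fourierLp ∞ n), coeFn_fourierLp ∞ n, coeFn_fourierLp ∞ (-n)]
    with x h1 h2 h3
  rw [h1, h2, h3, fourier_neg]
  rfl

theorem mulOp_zfun (n : ℤ) : mulOp zfun (zpowL2 n) = zpowL2 (n + 1) := by
  rw [zfun, mulOp_fourierLp, add_comm]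

theorem mulOp_star_zfun (n : ℤ) : mulOp (star zfun) (zpowL2 n) = zpowL2 (n - 1) := by
  rw [zfun, star_fourierLp, mulOp_fourierLp]
  congr 1; ring

theorem inner_zpowL2 (m n : ℤ) : inner ℂ (zpowL2 m) (zpowL2 n) = if m = n then (1 : ℂ) else 0 :=
  orthonormal_iff_ite.1 orthonormal_fourier m n

theorem fourierCoeff_eq_inner (f : L2) (n : ℤ) : fourierCoeff f n = inner ℂ (zpowL2 n) f := by
  rw [← fourierBasis_repr, fourierBasis.repr_apply_apply, coe_fourierBasis]

/-! ### The Hardy space -/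

theorem mem_H2_iff {f : L2} : f ∈ H2 ↔ ∀ n : ℤ, n < 0 → inner ℂ (zpowL2 n) f = 0 := by
  simp_rw [← fourierCoeff_eq_inner]
  rfl

theorem ext_inner_zpowL2 {f : L2} (h : ∀ n, inner ℂ (zpowL2 n) f = 0) : f = 0 := by
  refine fourierBasis.repr.map_eq_zero_iff.1 (lp.ext (funext fun n => ?_))
  rw [fourierBasis.repr_apply_apply, coe_fourierBasis]
  exact h n

theorem zpowL2_mem_H2 (n : ℕ) : zpowL2 n ∈ H2 :=
  mem_H2_iff.2 fun m hm => by rw [inner_zpowL2, if_neg]; omega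

theorem mulOp_zfun_mem_H2 {f : L2} (hf : f ∈ H2) : mulOp zfun f ∈ H2 :=
  mem_H2_iff.2 fun n hn => by
    rw [inner_mulOp_right, mulOp_star_zfun]
    exact mem_H2_iff.1 hf _ (by omega)

theorem eq_zero_of_mem_H2 {f : L2} (hf : f ∈ H2) (h : ∀ n : ℕ, inner ℂ (zpowL2 n) f = 0) :
    f = 0 := by
  refine ext_inner_zpowL2 fun n => ?_
  rcases lt_or_ge n 0 with hn | hn
  · exact mem_H2_iff.1 hf n hn
  · lift n to ℕ using hn
    exact h n

theorem inner_orthogonalProjectionOnto_of_mem (K : Submodule ℂ L2) [K.HasOrthogonalProjection]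
    {f : L2} (hf : f ∈ K) (g : L2) :
    inner ℂ f (K.orthogonalProjectionOnto g : L2) = inner ℂ f g :=
  K.inner_orthogonalProjectionOnto_eq_of_mem_left ⟨f, hf⟩ g

theorem inner_szego {f : L2} (hf : f ∈ H2) (g : L2) :
    inner ℂ f (szego g : L2) = inner ℂ f g :=
  inner_orthogonalProjectionOnto_of_mem H2 hf g

theorem inner_szego_left {f : L2} (hf : f ∈ H2) (g : L2) :
    inner ℂ (szego g : L2) f = inner ℂ g f := by
  rw [← inner_conj_symm, inner_szego hf, inner_conj_symm]

/-- Functions whose Fourier coefficients of non-negative index vanish are orthogonal to `H²`. -/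
theorem inner_eq_zero_of_mem_H2 {f g : L2} (hf : f ∈ H2)
    (h : ∀ n : ℕ, inner ℂ (zpowL2 n) g = 0) : inner ℂ f g = 0 := by
  have : (szego g : L2) = 0 := eq_zero_of_mem_H2 (szego g).2 fun n => by
    rw [inner_szego (zpowL2_mem_H2 n), h]
  rw [← inner_szego hf, this, inner_zero_right]

/-- `H²` splits as `ℂ ⊕ z H²`. -/
theorem exists_eq_add_mulOp_zfun {f : L2} (hf : f ∈ H2) :
    ∃ g ∈ H2, f = inner ℂ (zpowL2 0) f • zpowL2 0 + mulOp zfun g := by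
  refine ⟨mulOp (star zfun) (f - inner ℂ (zpowL2 0) f • zpowL2 0), ?_, ?_⟩
  · refine mem_H2_iff.2 fun n hn => ?_
    rw [inner_mulOp_right, star_star, mulOp_zfun, inner_sub_right, inner_smul_right, inner_zpowL2]
    rcases eq_or_ne (n + 1) 0 with h | h
    · simp [h]
    · rw [if_neg h, mem_H2_iff.1 hf _ (by omega)]
      simp
  · rw [mulOp_comm, mulOp_star_mulOp norm_zfun]
    abel

/-! ### Beurling subspaces and model spaces -/

namespace InnerFunction

variable (θ : InnerFunction)

theorem mulOp_mem_beurling {u : L2} (hu : u ∈ H2) : mulOp θ.fn u ∈ beurling θ :=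
  Submodule.mem_map_of_mem hu

theorem beurling_le_H2 : beurling θ ≤ H2 := by
  rintro _ ⟨u, hu, rfl⟩
  refine mem_H2_iff.2 fun n hn => ?_
  rw [← inner_conj_symm]
  change star (inner ℂ (mulOp θ.fn u) _) = 0
  rw [inner_mulOp_left, inner_eq_zero_of_mem_H2 hu, star_zero]
  intro k
  rw [inner_mulOp_right, star_star, ← inner_conj_symm]
  -- `⟨θ zᵏ, zⁿ⟩ = ⟨θ, zⁿ⁻ᵏ⟩`
  have : zpowL2 n = mulOp (fourierLp ∞ k) (zpowL2 (n - k)) := by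
    rw [mulOp_fourierLp]; congr 1; ring
  have h2 : zpowL2 k = mulOp (fourierLp ∞ k) (zpowL2 0) := by
    rw [mulOp_fourierLp, add_zero]
  rw [this, h2, mulOp_comm, inner_mulOp_mulOp (norm_fourierLp k), ← toL2_eq_mulOp,
    mem_H2_iff.1 θ.mem_H2 _ (by omega), map_zero]

theorem mulOp_zfun_mem_beurling {h : L2} (hh : h ∈ beurling θ) : mulOp zfun h ∈ beurling θ := by
  obtain ⟨u, hu, rfl⟩ := hh
  exact mulOp_comm θ.fn zfun u ▸ θ.mulOp_mem_beurling (mulOp_zfun_mem_H2 hu)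

theorem mem_modelSpace_iff {f : L2} :
    f ∈ modelSpace θ ↔ f ∈ H2 ∧ ∀ u ∈ H2, inner ℂ (mulOp θ.fn u) f = 0 := by
  rw [modelSpace, Submodule.mem_inf, Submodule.mem_orthogonal]
  exact and_congr_right fun _ => ⟨fun h u hu => h _ (θ.mulOp_mem_beurling hu), fun h v hv => by
    obtain ⟨u, hu, rfl⟩ := hv
    exact h u hu⟩

end InnerFunction

/-! ### Bounded functions from contractive Toeplitz forms -/

theorem norm_sq_eq_integral (f : L2) : ‖f‖ ^ 2 = ∫ x, ‖f x‖ ^ 2 ∂μT := by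
  rw [norm_sq_eq_re_inner (𝕜 := ℂ), L2.inner_def]
  have : ∀ x, inner ℂ (f x) (f x) = ((‖f x‖ ^ 2 : ℝ) : ℂ) := fun x => by
    rw [inner_self_eq_norm_sq_to_K]; simp
  simp_rw [this]
  rw [integral_complex_ofReal]
  exact Complex.ofReal_re _

theorem integrable_norm_sq (f : L2) : Integrable (fun x => ‖f x‖ ^ 2) μT :=
  MemLp.integrable_norm_pow (p := 2) (by exact_mod_cast Lp.memLp f) two_ne_zero

/-- The norm of an `L²` function is determined by its pairings with trigonometric polynomials. -/
theorem norm_le_of_forall_trigPoly {f : L2} {C : ℝ}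
    (h : ∀ (s : Finset ℤ) (b : ℤ → ℂ), ‖inner ℂ (∑ i ∈ s, b i • zpowL2 i) f‖ ≤
      C * ‖∑ i ∈ s, b i • zpowL2 i‖) (hC : 0 ≤ C) : ‖f‖ ≤ C := by
  have hs := fourierBasis.hasSum_repr f
  refine le_of_tendsto hs.norm (Filter.Eventually.of_forall fun s => ?_)
  simp_rw [fourierBasis.repr_apply_apply, coe_fourierBasis]
  -- the pairing of `f` with its partial Fourier sum is the square of the norm of that sum
  have h1 := h s fun i => inner ℂ (zpowL2 i) f
  set v := ∑ i ∈ s, inner ℂ (zpowL2 i) f • zpowL2 i with hv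
  have h2 : inner ℂ v f = inner ℂ v v := by
    conv_lhs => rw [hv, sum_inner]
    conv_rhs => rw [hv, sum_inner]
    refine Finset.sum_congr rfl fun i hi => ?_
    rw [← hv, inner_smul_left, inner_smul_left, hv, inner_sum]
    simp [inner_smul_right, inner_zpowL2, hi]
  rw [h2, inner_self_eq_norm_sq_to_K, norm_pow] at h1
  simp only [Complex.coe_algebraMap, Complex.norm_real, norm_norm] at h1
  rcases (norm_nonneg v).eq_or_lt with h0 | h0
  · exact h0 ▸ hC
  · exact le_of_mul_le_mul_right (by rwa [sq] at h1) h0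

theorem norm_sq_trigPoly (s : Finset ℤ) (b : ℤ → ℂ) :
    ‖∑ i ∈ s, b i • zpowL2 i‖ ^ 2 = ∑ i ∈ s, ‖b i‖ ^ 2 := by
  have h := orthonormal_fourier (T := (1 : ℝ)) |>.inner_sum b b s
  rw [norm_sq_eq_re_inner (𝕜 := ℂ), h, map_sum]
  refine Finset.sum_congr rfl fun i _ => ?_
  rw [Complex.conj_mul', ← Complex.ofReal_pow]
  exact Complex.ofReal_re _

theorem coeFn_star_L2 (f : L2) : (star f : L2) =ᵐ[μT] fun x => star (f x) :=
  Lp.coeFn_star f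

theorem inner_toL2_mulOp (w v : Linf) (f : L2) :
    inner ℂ (toL2 w) (mulOp v f) = inner ℂ (mulOp w (star f)) (toL2 v) := by
  rw [L2.inner_def, L2.inner_def]
  refine integral_congr_ae ?_
  filter_upwards [coeFn_toL2 w, coeFn_toL2 v, coeFn_mulOp v f, coeFn_mulOp w (star f),
    coeFn_star_L2 f] with x h1 h2 h3 h4 h5
  rw [h1, h2, h3, h4, h5]
  simp only [RCLike.inner_apply, map_mul, Complex.star_def, Complex.conj_conj]
  ring

/-- If multiplication by `f ∈ L²` is contractive on bounded functions, then `|f| ≤ 1`: test on the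
indicator function of `{|f| > 1}`. -/
theorem ae_norm_le_one_of_norm_mulOp_le {f : L2} (h : ∀ w : Linf, ‖mulOp w f‖ ≤ ‖toL2 w‖) :
    ∀ᵐ x ∂μT, ‖f x‖ ≤ 1 := by
  let E : Set Torus := {x | 1 < ‖f x‖}
  have hE : MeasurableSet E := 
    measurableSet_lt measurable_const (Lp.stronglyMeasurable f).norm.measurable
  let w : Linf := indicatorConstLp ∞ hE (measure_ne_top μT E) (1 : ℂ)
  have hw : w =ᵐ[μT] E.indicator fun _ => (1 : ℂ) := indicatorConstLp_coeFn
  have h1 : ‖mulOp w f‖ ^ 2 ≤ ‖toL2 w‖ ^ 2 := by gcongr; exact h w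
  rw [norm_sq_eq_integral, norm_sq_eq_integral, ← sub_nonpos, ← integral_sub
    (integrable_norm_sq _) (integrable_norm_sq _)] at h1
  have h2 : (fun x => ‖mulOp w f x‖ ^ 2 - ‖toL2 w x‖ ^ 2) =ᵐ[μT]
      E.indicator fun x => ‖f x‖ ^ 2 - 1 := by
    filter_upwards [hw, coeFn_mulOp w f, coeFn_toL2 w] with x h1 h2 h3
    rw [h2, h3, h1]
    by_cases hx : x ∈ E <;> simp [hx]
  have h3 : 0 ≤ E.indicator fun x => ‖f x‖ ^ 2 - 1 := by
    intro x
    refine Set.indicator_nonneg (fun y hy => ?_) x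
    have : 1 < ‖f y‖ := hy
    nlinarith
  have h4 : 0 ≤ᵐ[μT] fun x => ‖mulOp w f x‖ ^ 2 - ‖toL2 w x‖ ^ 2 := by
    filter_upwards [h2] with x hx
    rw [hx]
    exact h3 x
  have h5 := (integral_eq_zero_iff_of_nonneg_ae h4
    ((integrable_norm_sq _).sub (integrable_norm_sq _))).1
    (h1.antisymm (integral_nonneg_of_ae h4))
  filter_upwards [h2, h5] with x hx h0
  by_contra hlt
  have hx1 : x ∈ E := not_le.1 hlt
  rw [hx, Set.indicator_of_mem hx1, Pi.zero_apply] at h0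
  have : 1 < ‖f x‖ := hx1
  nlinarith

/-- A two-sided sequence whose Toeplitz form is contractive is the sequence of Fourier coefficients
of a bounded function. -/
theorem exists_Linf_of_contractive_toeplitz (c : ℤ → ℂ)
    (hc : ∀ (s : Finset ℤ) (p q : ℤ → ℂ),
      ‖∑ i ∈ s, ∑ j ∈ s, p i * star (q j) * c (i - j)‖ ^ 2 ≤
        (∑ i ∈ s, ‖p i‖ ^ 2) * ∑ j ∈ s, ‖q j‖ ^ 2) :
    ∃ f : Linf, ∀ n, inner ℂ (zpowL2 n) (toL2 f) = c n := by
  have hsum : ∀ s : Finset ℤ, ∑ i ∈ s, ‖c i‖ ^ 2 ≤ 1 := by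
    intro s
    refine (Finset.sum_le_sum_of_subset_of_nonneg (Finset.subset_insert 0 s)
      fun i _ _ => sq_nonneg ‖c i‖).trans ?_
    have h := hc (insert 0 s) (fun i => star (c i)) (Pi.single 0 1)
    have h1 : ∀ i, ∑ j ∈ insert 0 s, star (c i) * star ((Pi.single 0 1 : ℤ → ℂ) j) * c (i - j) =
        ((‖c i‖ ^ 2 : ℝ) : ℂ) := by
      intro i
      rw [Finset.sum_eq_single_of_mem 0 (Finset.mem_insert_self 0 s)]
      · simp [Complex.conj_mul']
      · intro j _ hj
        simp [hj]
    have h2 : ∑ j ∈ insert 0 s, ‖(Pi.single 0 1 : ℤ → ℂ) j‖ ^ 2 = 1 := by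
      rw [Finset.sum_eq_single_of_mem 0 (Finset.mem_insert_self 0 s)]
      · simp
      · intro j _ hj
        simp [hj]
    simp_rw [h1, h2, norm_star, ← Complex.ofReal_sum, Complex.norm_real, Real.norm_eq_abs,
      sq_abs] at h
    nlinarith
  have hmem : Memℓp c 2 := memℓp_gen' (C := 1) fun s => by simpa using hsum s
  let g : L2 := fourierBasis.repr.symm ⟨c, hmem⟩
  have hg : ∀ n, inner ℂ (zpowL2 n) g = c n := by
    intro n
    rw [show zpowL2 n = fourierBasis n from (congrFun coe_fourierBasis n).symm,
      ← fourierBasis.repr_apply_apply,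
      LinearIsometryEquiv.apply_symm_apply]
  -- multiplication by `g` is contractive on trigonometric polynomials
  have hV : ∀ (s : Finset ℤ) (b : ℤ → ℂ),
      ‖∑ j ∈ s, b j • mulOp (fourierLp ∞ j) g‖ ≤ ‖∑ j ∈ s, b j • zpowL2 j‖ := by
    intro s b
    refine norm_le_of_forall_trigPoly (fun t a => ?_) (norm_nonneg _)
    classical
    rw [← sq_le_sq₀ (norm_nonneg _) (by positivity), mul_pow, norm_sq_trigPoly, norm_sq_trigPoly]
    have h := hc (s ∪ t) (fun i => if i ∈ t then star (a i) else 0)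
      (fun j => if j ∈ s then star (b j) else 0)
    have h1 : ∀ i j, inner ℂ (zpowL2 i) (mulOp (fourierLp ∞ j) g) = c (i - j) := by
      intro i j
      rw [inner_mulOp_right, star_fourierLp, mulOp_fourierLp, hg]
      congr 1; ring
    have h2 : inner ℂ (∑ i ∈ t, a i • zpowL2 i) (∑ j ∈ s, b j • mulOp (fourierLp ∞ j) g) =
        ∑ i ∈ s ∪ t, ∑ j ∈ s ∪ t, (if i ∈ t then star (a i) else 0) *
          star (if j ∈ s then star (b j) else 0) * c (i - j) := by
      simp_rw [apply_ite star, star_star, star_zero, ite_mul, zero_mul, Finset.sum_ite_irrel,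
        mul_ite, mul_zero, ite_mul, zero_mul, Finset.sum_const_zero, Finset.sum_ite_mem]
      rw [Finset.union_inter_cancel_left, Finset.union_inter_cancel_right, sum_inner]
      refine Finset.sum_congr rfl fun i _ => ?_
      rw [inner_sum]
      refine Finset.sum_congr rfl fun j _ => ?_
      rw [inner_smul_left, inner_smul_right, h1, mul_assoc]
      rfl
    rw [h2, mul_comm]
    refine h.trans (le_of_eq ?_)
    simp_rw [apply_ite norm, norm_star, norm_zero, ite_pow, zero_pow two_ne_zero,
      Finset.sum_ite_mem]
    rw [Finset.union_inter_cancel_left, Finset.union_inter_cancel_right, mul_comm]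
  have hW : ∀ w : Linf, ‖mulOp w (star g)‖ ≤ ‖toL2 w‖ := by
    intro w
    refine norm_le_of_forall_trigPoly (fun s b => ?_) (norm_nonneg _)
    have h1 : inner ℂ (toL2 w) (∑ j ∈ s, b j • mulOp (fourierLp ∞ j) g) =
        inner ℂ (mulOp w (star g)) (∑ j ∈ s, b j • zpowL2 j) := by
      rw [inner_sum, inner_sum]
      refine Finset.sum_congr rfl fun j _ => ?_
      rw [inner_smul_right, inner_smul_right, inner_toL2_mulOp, toL2_fourierLp]
    rw [norm_inner_symm, ← h1]
    exact (norm_inner_le_norm _ _).trans (by gcongr; exact hV s b)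
  have hb : ∀ᵐ x ∂μT, ‖g x‖ ≤ 1 := by
    filter_upwards [ae_norm_le_one_of_norm_mulOp_le hW, coeFn_star_L2 g] with x h1 h2
    rwa [h2, norm_star] at h1
  have hgm : MemLp g ∞ μT := memLp_top_of_bound (Lp.aestronglyMeasurable g) 1 hb
  refine ⟨hgm.toLp g, fun n => ?_⟩
  have : toL2 (hgm.toLp g) = g := by
    apply Lp.ext
    filter_upwards [coeFn_toL2 (hgm.toLp g), hgm.coeFn_toLp] with x h1 h2
    rw [h1, h2]
  rw [this, hg]

/-! ### The flip operator -/

theorem flip_mulOp (φ : Linf) (f : L2) : flip (mulOp φ f) = mulOp (breve φ) (flip f) := by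
  apply Lp.ext
  filter_upwards [coeFn_flip (mulOp φ f), ae_neg (coeFn_mulOp φ f),
    coeFn_mulOp (breve φ) (flip f), coeFn_flip f, coeFn_breve φ] with x h1 h2 h3 h4 h5
  rw [h1, h2, h3, h4, h5]
  ring

theorem breve_zfun : breve zfun = star zfun := by
  apply Lp.ext
  filter_upwards [coeFn_breve zfun, ae_neg coeFn_zfun, coeFn_star_Linf zfun, coeFn_zfun]
    with x h1 h2 h3 h4
  rw [h1, h2, h3, h4, Complex.star_def, ← fourier_neg]
  simp [fourier_apply]

theorem flip_zpowL2 (n : ℤ) : flip (zpowL2 n) = zpowL2 (-n - 1) := by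
  apply Lp.ext
  filter_upwards [coeFn_flip (zpowL2 n), ae_neg (coeFn_fourierLp 2 n),
    coeFn_fourierLp 2 (-n - 1)] with x h1 h2 h3
  rw [h1, h2, h3, sub_eq_add_neg, fourier_add, Complex.star_def, ← fourier_neg, mul_comm]
  simp [fourier_apply]

/-- The flip operator is self-adjoint. -/
theorem inner_flip (f g : L2) : inner ℂ (flip f) g = inner ℂ f (flip g) := by
  rw [L2.inner_def, L2.inner_def, ← integral_neg_eq_self]
  refine integral_congr_ae ?_
  filter_upwards [ae_neg (coeFn_flip f), coeFn_flip g] with x h1 h2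
  rw [h1, h2]
  have : fourier 1 (-x) = star (fourier 1 x : ℂ) := by
    rw [Complex.star_def, ← fourier_neg]
    simp [fourier_apply]
  simp only [this, neg_neg, RCLike.inner_apply, map_mul, Complex.star_def, Complex.conj_conj]
  ring

/-! ### Nehari's theorem -/

theorem coe_shift (f : H2) : (shift f : L2) = mulOp zfun f :=
  congrArg Subtype.val
    (H2.orthogonalProjectionOnto_mem_subspace_eq_self ⟨_, mulOp_zfun_mem_H2 f.2⟩)

theorem coe_shift_pow (n m : ℕ) :
    (((shift ^ n) ⟨zpowL2 m, zpowL2_mem_H2 m⟩ : H2) : L2) = zpowL2 (n + m : ℕ) := by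
  induction n with
  | zero => simp
  | succ n ih =>
    rw [pow_succ']
    change ((shift ((shift ^ n) _) : H2) : L2) = _
    rw [coe_shift, ih, mulOp_zfun]
    congr 1
    push_cast
    ring

/-- Operators on `H²` are determined by their matrix with respect to the monomials. -/
theorem eq_of_inner_zpowL2 {A B : H2 →L[ℂ] H2}
    (h : ∀ k m : ℕ, inner ℂ (zpowL2 k) (A ⟨zpowL2 m, zpowL2_mem_H2 m⟩ : L2) =
      inner ℂ (zpowL2 k) (B ⟨zpowL2 m, zpowL2_mem_H2 m⟩ : L2)) : A = B := by
  rw [← sub_eq_zero]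
  set L := A - B with hL
  have h1 : ∀ m : ℕ, L ⟨zpowL2 m, zpowL2_mem_H2 m⟩ = 0 := fun m =>
    Subtype.ext (eq_zero_of_mem_H2 (L _).2 fun k => by
      rw [hL, sub_apply, Submodule.coe_sub, inner_sub_right, h, sub_self])
  have h2 : ∀ x, ContinuousLinearMap.adjoint L x = 0 := by
    intro x
    refine Subtype.ext (eq_zero_of_mem_H2 (ContinuousLinearMap.adjoint L x).2 fun m => ?_)
    have := ContinuousLinearMap.adjoint_inner_right L ⟨zpowL2 m, zpowL2_mem_H2 m⟩ x
    rw [h1, inner_zero_left] at this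
    exact this
  ext1 x
  have h3 := ContinuousLinearMap.adjoint_inner_right L x (L x)
  rw [h2, inner_zero_right] at h3
  exact inner_self_eq_zero.1 h3.symm

/-- **Nehari's theorem**: a bounded Hankel operator on `H²` has a bounded symbol. -/
theorem exists_symbol (Γ : H2 →L[ℂ] H2)
    (hΓ : ∀ x y : H2, inner ℂ (shift x) (Γ y) = inner ℂ x (Γ (shift y))) :
    ∃ ψ : Linf, Γ = szego ∘L flip ∘L mulOp ψ ∘L H2.subtypeL := by
  let e : H2 := ⟨zpowL2 (0 : ℕ), zpowL2_mem_H2 0⟩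
  obtain ⟨r, c, hc, hb⟩ := exists_toeplitz_of_hankel shift Γ
    (fun x => by
      rw [Submodule.coe_norm, coe_shift, norm_eq_sqrt_re_inner (𝕜 := ℂ),
        inner_mulOp_mulOp norm_zfun, ← norm_eq_sqrt_re_inner, Submodule.coe_norm])
    hΓ e (fun n => by
      rw [Submodule.coe_inner, coe_shift_pow, inner_zpowL2]
      simp)
  obtain ⟨f, hf⟩ := exists_Linf_of_contractive_toeplitz c hb
  have he : ∀ n : ℕ, (⟨zpowL2 n, zpowL2_mem_H2 n⟩ : H2) = (shift ^ n) e := fun n =>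
    Subtype.ext (by rw [coe_shift_pow, add_zero])
  have hmat : ∀ k m : ℕ, inner ℂ (zpowL2 k) (Γ ⟨zpowL2 m, zpowL2_mem_H2 m⟩ : L2) =
      r * star (c (k + m : ℕ)) := by
    intro k m
    rw [← hc, ← he, ← he]
    rfl
  -- `⟨𝒥(z̄ f̄ zᵐ), zᵏ⟩` is the conjugate of the Fourier coefficient of `f` at `k + m`; the flip takes
  -- `zᵏ` to `z⁻ᵏ⁻¹`, which the factor `z̄` of the symbol compensates
  refine ⟨(r : ℂ) • mulInf (star zfun) (star f), eq_of_inner_zpowL2 fun k m => ?_⟩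
  have hsmul : ∀ u : L2, mulOp ((r : ℂ) • mulInf (star zfun) (star f)) u =
      (r : ℂ) • mulOp (star zfun) (mulOp (star f) u) := fun u => by
    rw [← mulOp_mulInf, mulOp, map_smul]
    rfl
  have hk : zpowL2 (-k - 1) = mulOp (fourierLp ∞ (-k - 1)) (zpowL2 0) := by
    rw [mulOp_fourierLp, add_zero]
  have hm : zpowL2 (m - 1) = mulOp (fourierLp ∞ (-k - 1)) (zpowL2 (k + m : ℕ)) := by
    rw [mulOp_fourierLp]; congr 1; push_cast; ring
  rw [hmat]
  simp only [ContinuousLinearMap.comp_apply, Submodule.subtypeL_apply]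
  rw [inner_szego (zpowL2_mem_H2 k), ← inner_flip, flip_zpowL2, hsmul, inner_smul_right,
    mulOp_comm, mulOp_star_zfun, inner_mulOp_right, star_star, hk, hm, mulOp_comm,
    inner_mulOp_mulOp (norm_fourierLp _), ← toL2_eq_mulOp, ← hf, Complex.star_def, inner_conj_symm]

/-! ### Shifts on model spaces and Beurling subspaces -/

theorem compressedShift_adjoint_apply (θ : InnerFunction) (d : modelSpace θ) :
    ContinuousLinearMap.adjoint (compressedShift θ) d =
      (modelSpace θ).orthogonalProjectionOnto (mulOp (star zfun) d) := by
  refine ext_inner_left ℂ fun k => ?_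
  rw [ContinuousLinearMap.adjoint_inner_right, Submodule.coe_inner, Submodule.coe_inner,
    inner_orthogonalProjectionOnto_of_mem _ k.2, ← inner_mulOp_left, ← inner_conj_symm,
    compressedShift]
  simp only [ContinuousLinearMap.comp_apply, Submodule.subtypeL_apply]
  rw [inner_orthogonalProjectionOnto_of_mem _ d.2, inner_conj_symm]

theorem backwardShift_apply (f : H2) : backwardShift f = szego (mulOp (star zfun) f) := by
  refine ext_inner_left ℂ fun k => ?_
  rw [backwardShift, ContinuousLinearMap.adjoint_inner_right, Submodule.coe_inner,
    Submodule.coe_inner, inner_szego k.2, ← inner_mulOp_left, coe_shift]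

theorem coe_beurlingShift (η : InnerFunction) (h : beurling η) :
    (beurlingShift η h : L2) = mulOp zfun h :=
  congrArg Subtype.val ((beurling η).orthogonalProjectionOnto_mem_subspace_eq_self
    ⟨_, η.mulOp_zfun_mem_beurling h.2⟩)

namespace InnerFunction

variable (θ : InnerFunction)

/-- On functions orthogonal to `θ H²` the projections onto `K_θ` and onto `H²` agree. -/
theorem orthogonalProjectionOnto_modelSpace_eq_szego {g : L2}
    (hg : ∀ u ∈ H2, inner ℂ (mulOp θ.fn u) g = 0) :
    ((modelSpace θ).orthogonalProjectionOnto g : L2) = szego g := by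
  have h1 : (szego g : L2) ∈ modelSpace θ := θ.mem_modelSpace_iff.2 ⟨(szego g).2, fun u hu => by
    rw [inner_szego (θ.beurling_le_H2 (θ.mulOp_mem_beurling hu)), hg u hu]⟩
  have h2 := (modelSpace θ).sub_mem h1 ((modelSpace θ).orthogonalProjectionOnto g).2
  rw [eq_comm, ← sub_eq_zero, ← inner_self_eq_zero (𝕜 := ℂ)]
  conv_lhs => rw [inner_sub_right]
  rw [inner_szego h2.1, inner_orthogonalProjectionOnto_of_mem _ h2, sub_self]

theorem inner_mulOp_toL2 {u : L2} : inner ℂ (mulOp θ.fn u) (toL2 θ.fn) = inner ℂ u (zpowL2 0) := by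
  rw [toL2_eq_mulOp, inner_mulOp_mulOp θ.norm_eq_one]

theorem inner_mulOp_zfun_zpowL2_zero {u : L2} (hu : u ∈ H2) :
    inner ℂ (mulOp zfun u) (zpowL2 0) = 0 := by
  rw [inner_mulOp_left, mulOp_star_zfun, ← inner_conj_symm, mem_H2_iff.1 hu _ (by norm_num),
    map_zero]

theorem coe_backwardShift_toH2 : (backwardShift θ.toH2 : L2) =
    (modelSpace θ).orthogonalProjectionOnto (mulOp (star zfun) (toL2 θ.fn)) := by
  rw [backwardShift_apply, orthogonalProjectionOnto_modelSpace_eq_szego]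
  · rfl
  · intro u hu
    rw [inner_mulOp_right, star_star, mulOp_comm, inner_mulOp_toL2,
      inner_mulOp_zfun_zpowL2_zero hu]

/-- For `k ∈ K_θ`, the function `z k` lies in `K_θ ⊕ ℂ θ`. -/
theorem mulOp_zfun_sub_mem_modelSpace {k : L2} (hk : k ∈ modelSpace θ) :
    mulOp zfun k - inner ℂ (toL2 θ.fn) (mulOp zfun k) • toL2 θ.fn ∈ modelSpace θ := by
  refine θ.mem_modelSpace_iff.2
    ⟨H2.sub_mem (mulOp_zfun_mem_H2 hk.1) (H2.smul_mem _ θ.mem_H2), fun u hu => ?_⟩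
  obtain ⟨w, hw, hu'⟩ := exists_eq_add_mulOp_zfun hu
  rw [hu', map_add, map_smul, ← toL2_eq_mulOp, inner_add_left, inner_smul_left]
  have h1 : inner ℂ (toL2 θ.fn) (toL2 θ.fn) = (1 : ℂ) := by
    rw [toL2_eq_mulOp, inner_mulOp_mulOp θ.norm_eq_one, inner_zpowL2, if_pos rfl]
  have h2 : inner ℂ (mulOp θ.fn (mulOp zfun w)) (mulOp zfun k) = 0 := by
    rw [mulOp_comm, inner_mulOp_mulOp norm_zfun, (θ.mem_modelSpace_iff.1 hk).2 w hw]
  have h3 : inner ℂ (mulOp θ.fn (mulOp zfun w)) (toL2 θ.fn) = 0 := by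
    rw [inner_mulOp_toL2, inner_mulOp_zfun_zpowL2_zero hw]
  rw [inner_sub_right, inner_sub_right, inner_smul_right, inner_smul_right, h1, h2, h3]
  ring

/-- The compression of the backward shift to `K_θ` sees only the component along `θ` of a function
orthogonal to `K_θ`. -/
theorem orthogonalProjectionOnto_mulOp_star_zfun {r : L2}
    (hr : ∀ k ∈ modelSpace θ, inner ℂ k r = 0) :
    ((modelSpace θ).orthogonalProjectionOnto (mulOp (star zfun) r) : L2) =
      inner ℂ (toL2 θ.fn) r • (backwardShift θ.toH2 : L2) := by
  rw [coe_backwardShift_toH2, ← Submodule.coe_smul]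
  refine congrArg Subtype.val (ext_inner_left ℂ fun k => ?_)
  rw [inner_smul_right, Submodule.coe_inner, Submodule.coe_inner,
    inner_orthogonalProjectionOnto_of_mem _ k.2, inner_orthogonalProjectionOnto_of_mem _ k.2,
    ← inner_mulOp_left, ← inner_mulOp_left]
  have h := hr _ (θ.mulOp_zfun_sub_mem_modelSpace k.2)
  rw [inner_sub_left, inner_smul_left, inner_conj_symm, sub_eq_zero] at h
  rw [h, mul_comm]

end InnerFunction

/-! ### Restricted Hankel operators -/

theorem inner_hankelVector (η θ : InnerFunction) (φ : Linf) {h : L2} (hh : h ∈ H2) :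
    inner ℂ (hankelVector η θ φ : L2) h =
      inner ℂ (toL2 θ.fn) (flip (mulOp (mulInf η.fn φ) h)) := by
  rw [hankelVector, inner_szego_left hh, ← inner_flip, toL2_eq_mulOp θ.fn, flip_mulOp,
    flip_zpowL2, inner_mulOp_right (mulInf η.fn φ), ← mulOp_toL2, star_mulInf zfun,
    ← mulOp_toL2, toL2_eq_mulOp, mulOp_comm (star zfun), mulOp_star_zfun, mulOp_comm]
  rfl

/-- A restricted Hankel operator intertwines the two shifts up to a rank-one operator. -/
theorem restrictedHankel_intertwining (η θ : InnerFunction) (φ : Linf) (h : beurling η) :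
    ((restrictedHankel η θ (mulInf η.fn φ) (beurlingShift η h) -
        ContinuousLinearMap.adjoint (compressedShift θ)
          (restrictedHankel η θ (mulInf η.fn φ) h) : modelSpace θ) : L2) =
      inner ℂ (hankelVector η θ φ : L2) (h : L2) • (backwardShift θ.toH2 : L2) := by
  rw [inner_hankelVector η θ φ (η.beurling_le_H2 h.2), compressedShift_adjoint_apply]
  simp only [restrictedHankel, ContinuousLinearMap.comp_apply, Submodule.subtypeL_apply]
  set g := flip (mulOp (mulInf η.fn φ) (h : L2)) with hg
  have h1 : flip (mulOp (mulInf η.fn φ) (beurlingShift η h : L2)) = mulOp (star zfun) g := by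
    rw [coe_beurlingShift, mulOp_comm, flip_mulOp, breve_zfun]
  rw [h1, ← map_sub, ← map_sub, θ.orthogonalProjectionOnto_mulOp_star_zfun, inner_sub_right]
  · have h2 : inner ℂ (toL2 θ.fn) ((modelSpace θ).orthogonalProjectionOnto g : L2) = 0 := by
      rw [toL2_eq_mulOp]
      exact (θ.mem_modelSpace_iff.1 ((modelSpace θ).orthogonalProjectionOnto g).2).2 _
        (zpowL2_mem_H2 0)
    rw [h2, sub_zero]
  · intro k hk
    rw [inner_sub_right, inner_orthogonalProjectionOnto_of_mem _ hk, sub_self]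

/-- The commutant case: an operator that intertwines the shift on `η H²` with the backward shift on
`K_θ` is a restricted Hankel operator, because its composition with `M_η` is a Hankel operator on
`H²`, to which Nehari's theorem applies. -/
theorem isRestrictedHankel_of_intertwining (η θ : InnerFunction)
    (D : beurling η →L[ℂ] modelSpace θ)
    (hD : ∀ h, D (beurlingShift η h) = ContinuousLinearMap.adjoint (compressedShift θ) (D h)) :
    IsRestrictedHankel η θ D := by
  let Mη : H2 →L[ℂ] beurling η :=
    (mulOp η.fn ∘L H2.subtypeL).codRestrict (beurling η) fun u => η.mulOp_mem_beurling u.2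
  let ι : modelSpace θ →L[ℂ] H2 :=
    (modelSpace θ).subtypeL.codRestrict H2 fun k => k.2.1
  have hM : ∀ u, Mη (shift u) = beurlingShift η (Mη u) := by
    intro u
    refine Subtype.ext ?_
    rw [coe_beurlingShift]
    change mulOp η.fn (shift u : L2) = mulOp zfun (mulOp η.fn u)
    rw [coe_shift, mulOp_comm]
  obtain ⟨ψ, hψ⟩ := exists_symbol (ι ∘L D ∘L Mη) fun x y => by
    change inner ℂ (shift x : L2) (D (Mη y) : L2) = inner ℂ (x : L2) (D (Mη (shift y)) : L2)
    rw [hM, hD, compressedShift_adjoint_apply, coe_shift, inner_mulOp_left,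
      θ.orthogonalProjectionOnto_modelSpace_eq_szego, inner_szego x.2]
    intro u hu
    rw [inner_mulOp_right, star_star, mulOp_comm]
    exact (θ.mem_modelSpace_iff.1 (D (Mη y)).2).2 _ (mulOp_zfun_mem_H2 hu)
  refine ⟨mulInf (star η.fn) ψ, ?_⟩
  ext1 h
  obtain ⟨_, u, hu, rfl⟩ := h
  have h1 : (D (Mη ⟨u, hu⟩) : L2) = szego (flip (mulOp ψ u)) :=
    congrArg Subtype.val (congrArg (fun F : H2 →L[ℂ] H2 => F ⟨u, hu⟩) hψ)
  have h2 : mulOp (mulInf (star η.fn) ψ) (mulOp η.fn u) = mulOp ψ u := by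
    rw [mulOp_mulInf, mulOp_comm ψ, mulOp_star_mulOp η.norm_eq_one]
  refine ext_inner_left ℂ fun k => ?_
  rw [Submodule.coe_inner, Submodule.coe_inner]
  change inner ℂ (k : L2) (D (Mη ⟨u, hu⟩) : L2) =
    inner ℂ (k : L2) ((modelSpace θ).orthogonalProjectionOnto
      (flip (mulOp (mulInf (star η.fn) ψ) (mulOp η.fn u))) : L2)
  rw [h1, h2, inner_szego k.2.1, inner_orthogonalProjectionOnto_of_mem _ k.2]

end RestrictedHankel

end

/-- A bounded operator `X : ηH² → K_θ` is a restricted Hankel operator if and only if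
`X 𝒮_(η) - S_θ* X = S*(θ) ⊗ P(θ̆ · conj (z η φ))` for some `φ ∈ L^∞`, where
`(u ⊗ v) h = ⟨h, v⟩ u`.  The operator identity is one between operators from `ηH²` into `L²`. -/
theorem mainTheorem2 (η θ : RestrictedHankel.InnerFunction)
    (X : RestrictedHankel.beurling η →L[ℂ] RestrictedHankel.modelSpace θ) :
    RestrictedHankel.IsRestrictedHankel η θ X ↔
      ∃ φ : RestrictedHankel.Linf,
        (RestrictedHankel.modelSpace θ).subtypeL ∘L
            (X ∘L RestrictedHankel.beurlingShift η -
              ContinuousLinearMap.adjoint (RestrictedHankel.compressedShift θ) ∘L X) =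
          InnerProductSpace.rankOne ℂ
              (RestrictedHankel.backwardShift θ.toH2 : RestrictedHankel.L2)
              (RestrictedHankel.hankelVector η θ φ : RestrictedHankel.L2) ∘L
            (RestrictedHankel.beurling η).subtypeL := by
  constructor
  · rintro ⟨ψ, rfl⟩
    refine ⟨RestrictedHankel.mulInf (star η.fn) ψ, ContinuousLinearMap.ext fun h => ?_⟩
    have := RestrictedHankel.restrictedHankel_intertwining η θ
      (RestrictedHankel.mulInf (star η.fn) ψ) h
    rw [RestrictedHankel.mulInf_star_mulInf η.norm_eq_one] at this
    exact this
  · rintro ⟨φ, hφ⟩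
    -- `X` and the restricted Hankel operator with symbol `η φ` satisfy the same equation
    obtain ⟨ψ, hψ⟩ := RestrictedHankel.isRestrictedHankel_of_intertwining η θ
      (X - RestrictedHankel.restrictedHankel η θ (RestrictedHankel.mulInf η.fn φ)) fun h => by
        have h1 := RestrictedHankel.restrictedHankel_intertwining η θ φ h
        have h2 : ((X (RestrictedHankel.beurlingShift η h) -
            ContinuousLinearMap.adjoint (RestrictedHankel.compressedShift θ) (X h) :
              RestrictedHankel.modelSpace θ) : RestrictedHankel.L2) = _ :=
          congrArg (fun F => F h) hφ
        have h3 := Subtype.ext (h2.trans h1.symm)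
        rw [sub_apply, sub_apply, map_sub]
        rw [sub_eq_sub_iff_add_eq_add] at h3 ⊢
        rw [h3, add_comm]
    refine ⟨ψ + RestrictedHankel.mulInf η.fn φ, ?_⟩
    rw [sub_eq_iff_eq_add.1 hψ]
    ext1 h
    simp [RestrictedHankel.restrictedHankel, RestrictedHankel.mulOp]
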